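/- Let $n>2$ be an integer. For a vector $v=(v_1,\dots,v_n)$ let $L_v$ be the $n\times n$ matrix with diagonal entries $v_1,\dots,v_n$, with entries $1$ in the positions $(i,i+1)$ and $(i+1,i)$ for $1\le i<n$ and in the positions $(1,n)$ and $(n,1)$, and with all other entries $0$ (the Floquet matrix, at $z=1$, of the discrete Laplacian on $\mathbb{Z}$ plus the $n\mathbb{Z}$-periodic potential $v$). Put $D_v(\lambda)=\det(L_v-\lambda \mathrm{Id})$. Treating $v_1,\dots,v_n$ as indeterminates, define the spectral invariants of the zero potential $$p_k=(-1)^{n-k}\,[\lambda^{n-k}]\bigl(D_v(\lambda)-D_{\mathbf 0}(\lambda)\bigr)\in\mathbb{C}[v_1,\dots,v_n]\qquad(1\le k\le n),$$ where $[\lambda^{j}]f$ denotes the coefficient of $\lambda^{j}$ in $f$, and let $I=\langle p_1,\dots,p_n\rangle\subseteq\mathbb{C}[v_1,\dots,v_n]$, with vanishing set $V(I)\subseteq\mathbb{C}^n$. The multiplicity of a point $x$ in $V(I)$ is taken with respect to the ideal $I$ itself (not its radical): it is $\dim_{\mathbb{C}}\bigl(\mathbb{C}[v]_{\mathfrak{m}_x}/I\,\mathbb{C}[v]_{\mathfrak{m}_x}\bigr)$,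 where $\mathfrak{m}_x$ is the maximal ideal of the polynomials vanishing at $x$. Theorem. The multiplicity of $\mathbf 0$ in $V(I)$ is (finite and) at least $2n$. Consequently, $V(I)$ is a finite set that contains at least $1$ and at most $n!-2n+1$ distinct points. -/

import Mathlib

/-- The Floquet matrix `L_V(z)` of the discrete Schrödinger operator on `ℤ` with the `nℤ`-periodic
potential `V = (v 0, …, v (n - 1))`: the potential on the diagonal, `1` next to the diagonal,
`z⁻¹` in the upper right corner and `z` in the lower left corner. -/
def floquetMatrix {R : Type*} [CommRing R] {n : ℕ} (v : Fin n → R) (z : Rˣ) :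
    Matrix (Fin n) (Fin n) R :=
  Matrix.of fun i j =>
    (if i = j then v i else 0)
      + (if (j : ℕ) = (i : ℕ) + 1 then 1 else 0)
      + (if (i : ℕ) = (j : ℕ) + 1 then 1 else 0)
      + (if (i : ℕ) = 0 ∧ (j : ℕ) + 1 = n then ((z⁻¹ : Rˣ) : R) else 0)
      + (if (i : ℕ) + 1 = n ∧ (j : ℕ) = 0 then (z : R) else 0)

/-- The characteristic polynomial `D_V(λ) = det (L_V - λ I)`, where `L_V = L_V(1)`; the variable
`λ` is `Polynomial.X`. -/
noncomputable def floquetCharpoly {R : Type*} [CommRing R] {n : ℕ} (v : Fin n → R) :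
    Polynomial R :=
  Matrix.det ((floquetMatrix v 1).map Polynomial.C - Matrix.scalar (Fin n) Polynomial.X)

/-- `ζ_V = D_V(λ) - D_0(λ)` for the potential `V` whose values are the indeterminates of
`ℂ[v_1, …, v_n]`. -/
noncomputable def zetaPoly (n : ℕ) : Polynomial (MvPolynomial (Fin n) ℂ) :=
  floquetCharpoly (fun i : Fin n => (MvPolynomial.X i : MvPolynomial (Fin n) ℂ))
    - floquetCharpoly (fun _ : Fin n => (0 : MvPolynomial (Fin n) ℂ))

/-- The spectral invariant `p_k = (-1)^(n-k) [λ^(n-k)] ζ_V` (used for `1 ≤ k ≤ n`). -/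
noncomputable def spectralInvariant (n k : ℕ) : MvPolynomial (Fin n) ℂ :=
  (-1) ^ (n - k) * (zetaPoly n).coeff (n - k)

/-- The ideal of spectral invariants `I = ⟨p_1, …, p_n⟩` for the zero potential. -/
noncomputable def spectralIdeal (n : ℕ) : Ideal (MvPolynomial (Fin n) ℂ) :=
  Ideal.span (spectralInvariant n '' Set.Icc 1 n)

/-- The maximal ideal `𝔪_x` of the polynomials that vanish at the point `x`. -/
noncomputable def pointIdeal {n : ℕ} (x : Fin n → ℂ) : Ideal (MvPolynomial (Fin n) ℂ) :=
  RingHom.ker (MvPolynomial.eval x)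

instance pointIdeal_isPrime {n : ℕ} (x : Fin n → ℂ) : (pointIdeal x).IsPrime :=
  RingHom.ker_isPrime _

/-- The multiplicity of the point `x` in the (not necessarily reduced) scheme `V(J)`: the dimension
over `ℂ` of the local ring `ℂ[v]_{𝔪_x} / J ℂ[v]_{𝔪_x}`. (It is `0` if that dimension is infinite, and
if `x` does not lie on `V(J)`.) -/
noncomputable def pointMultiplicity {n : ℕ} (J : Ideal (MvPolynomial (Fin n) ℂ))
    (x : Fin n → ℂ) : ℕ :=
  Module.finrank ℂ
    (Localization.AtPrime (pointIdeal x) ⧸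
      J.map (algebraMap (MvPolynomial (Fin n) ℂ) (Localization.AtPrime (pointIdeal x))))

/-! The bounds come from squeezing the length of the scheme $V(I)$. By the Leibniz expansion, $p_k$
has leading form the elementary symmetric polynomial $e_k$. The algebra
$\mathbb{C}[v]/(e_1,\dots,e_n)$ is a quotient of the universal splitting algebra of $X^n$, free of
rank $n!$, and monomials spanning it still span $\mathbb{C}[v]/I$; hence $\dim\mathbb{C}[v]/I\le n!$
(`finrank_quotient_span_le_factorial`). By the Chinese remainder theorem, the multiplicity of the
origin plus the number of other points is at most this dimension (`pointMultiplicity_add_card_le`).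

It remains to show that the multiplicity of the origin is at least $2n$. Let $\mathfrak
m=(v_1,\dots,v_n)$. No $p_k$ has a constant term, and cyclic symmetry makes its linear part a
multiple of $e_1=p_1$. In $\mathbb{C}[v]/\mathfrak m^3$, of dimension $1+n+\binom{n+1}{2}$, the
relation $e_1$ costs at most $1+n$ dimensions and each other $p_k$ at most one
(`choose_le_pointMultiplicity_add_card`). So the multiplicity is at least $\binom{n+1}{2}-(n-1)$,
which suffices for $n\ge5$. For $n=4$ this falls short by one, but $p_3=e_3-2e_1$ costs nothing. For
$n=3$ the splitting algebra of $X^3$, of dimension $6$, is itself a quotient of $\mathbb{C}[v]/I$.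
-/

/-! ### Universal splitting algebras -/

section Splitting

open Polynomial

universe u

/-- Every monic polynomial `g` of degree `n` has a universal splitting algebra, which is free of
rank `n!` and generated by the adjoined roots. -/
theorem exists_universal_splitting_algebra (n : ℕ) : ∀ (B : Type u) [CommRing B] [Nontrivial B]
    (g : B[X]), g.Monic → g.natDegree = n →
    ∃ (S : Type u) (_ : CommRing S) (_ : Algebra B S) (r : Fin n → S),
      Nontrivial S ∧ Module.Free B S ∧ Module.Finite B S ∧ Module.finrank B S = n.factorial ∧
      g.map (algebraMap B S) = ∏ i, (X - C (r i)) ∧ Algebra.adjoin B (Set.range r) = ⊤ ∧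
      ∀ (Q : Type u) [CommRing Q] [Algebra B Q] (v : Fin n → Q),
        g.map (algebraMap B Q) = ∏ i, (X - C (v i)) → ∃ f : S →ₐ[B] Q, ∀ i, f (r i) = v i := by
  induction n with
  | zero =>
    intro B _ _ g hg hn
    refine ⟨B, inferInstance, inferInstance, Fin.elim0, inferInstance, inferInstance,
      inferInstance, by simp, ?_, ?_, ?_⟩
    · simp [hg.natDegree_eq_zero.mp hn]
    · exact Subsingleton.elim _ _
    · intro Q _ _ v _
      exact ⟨Algebra.ofId B Q, fun i => i.elim0⟩
  | succ n ih =>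
    intro B _ _ g hg hn
    have hA : Nontrivial (AdjoinRoot g) := by
      refine ⟨_, 0, (AdjoinRoot.powerBasis' hg).basis.ne_zero ⟨0, ?_⟩⟩
      rw [AdjoinRoot.powerBasis'_dim, hn]
      exact n.succ_pos
    have hfree : Module.Free B (AdjoinRoot g) := hg.free_adjoinRoot
    have hfin : Module.Finite B (AdjoinRoot g) := hg.finite_adjoinRoot
    have hrank : Module.finrank B (AdjoinRoot g) = n + 1 := by
      rw [(AdjoinRoot.powerBasis' hg).finrank, AdjoinRoot.powerBasis'_dim, hn]
    have hdvd : (X - C (AdjoinRoot.root g)) ∣ g.map (algebraMap B (AdjoinRoot g)) := by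
      rw [dvd_iff_isRoot]
      exact AdjoinRoot.isRoot_root g
    obtain ⟨g', hg'⟩ := hdvd
    have hmonic : g'.Monic := by
      have h := hg.map (algebraMap B (AdjoinRoot g))
      rw [hg'] at h
      exact (monic_X_sub_C _).of_mul_monic_left h
    have hdeg : g'.natDegree = n := by
      have h := congrArg natDegree hg'
      rw [hg.natDegree_map, hn, (monic_X_sub_C _).natDegree_mul hmonic, natDegree_X_sub_C] at h
      omega
    obtain ⟨S, _, _, r, hS, hSfree, hSfin, hSrank, hSmap, hSadj, hSuniv⟩ :=
      ih (AdjoinRoot g) g' hmonic hdeg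
    let : Algebra B S := ((algebraMap (AdjoinRoot g) S).comp
      (algebraMap B (AdjoinRoot g))).toAlgebra
    have : IsScalarTower B (AdjoinRoot g) S := IsScalarTower.of_algebraMap_eq' rfl
    refine ⟨S, inferInstance, inferInstance, Fin.cons (algebraMap _ S (AdjoinRoot.root g)) r, hS,
      Module.Free.trans (R := B) (S := AdjoinRoot g), Module.Finite.trans (AdjoinRoot g) S,
      ?_, ?_, ?_, ?_⟩
    · rw [← Module.finrank_mul_finrank B (AdjoinRoot g) S, hrank, hSrank, Nat.factorial_succ]
    · rw [IsScalarTower.algebraMap_eq B (AdjoinRoot g) S, ← Polynomial.map_map, hg',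
        Polynomial.map_mul, hSmap, Fin.prod_univ_succ]
      simp
    · have hroot : ∀ a : AdjoinRoot g, algebraMap (AdjoinRoot g) S a ∈ Algebra.adjoin B
          (Set.range (Fin.cons (algebraMap _ S (AdjoinRoot.root g)) r : Fin (n + 1) → S)) := by
        intro a
        have ha : a ∈ Algebra.adjoin B {AdjoinRoot.root g} := by
          rw [AdjoinRoot.adjoinRoot_eq_top]; trivial
        have h2 := (Algebra.adjoin B {AdjoinRoot.root g}).mem_map.mpr
          ⟨a, ha, (rfl : IsScalarTower.toAlgHom B (AdjoinRoot g) S a = _)⟩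
        rw [AlgHom.map_adjoin] at h2
        refine Algebra.adjoin_mono ?_ h2
        rintro _ ⟨_, rfl, rfl⟩
        exact ⟨0, by simp⟩
      rw [eq_top_iff]
      intro s _
      have hs : s ∈ Algebra.adjoin (AdjoinRoot g) (Set.range r) := by rw [hSadj]; trivial
      induction hs using Algebra.adjoin_induction with
      | mem x hx =>
        obtain ⟨i, rfl⟩ := hx
        exact Algebra.subset_adjoin ⟨i.succ, by simp⟩
      | algebraMap a => exact hroot a
      | add x y _ _ hx hy => exact add_mem (hx trivial) (hy trivial)
      | mul x y _ _ hx hy => exact mul_mem (hx trivial) (hy trivial)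
    · intro Q _ _ v hv
      have hv0 : g.eval₂ (algebraMap B Q) (v 0) = 0 := by
        rw [← eval_map, hv, eval_prod]
        exact Finset.prod_eq_zero (Finset.mem_univ 0) (by simp)
      let f₀ : AdjoinRoot g →ₐ[B] Q := AdjoinRoot.liftAlgHom g (Algebra.ofId B Q) (v 0) hv0
      have hf₀ : f₀ (AdjoinRoot.root g) = v 0 := AdjoinRoot.liftAlgHom_root ..
      let : Algebra (AdjoinRoot g) Q := f₀.toRingHom.toAlgebra
      have : IsScalarTower B (AdjoinRoot g) Q :=
        IsScalarTower.of_algebraMap_eq fun b => (f₀.commutes b).symm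
      have halg : algebraMap (AdjoinRoot g) Q (AdjoinRoot.root g) = v 0 := hf₀
      obtain ⟨f, hf⟩ := hSuniv Q (fun i => v i.succ) (by
        -- `Q` need not be a domain, but the monic factor $X-v_0$ can still be cancelled.
        apply (monic_X_sub_C (v 0)).isRegular.left
        have h := congrArg (Polynomial.map (algebraMap (AdjoinRoot g) Q)) hg'
        rw [Polynomial.map_map, ← IsScalarTower.algebraMap_eq, hv, Fin.prod_univ_succ,
          Polynomial.map_mul, Polynomial.map_sub, map_X, map_C, halg] at h
        exact h.symm)
      refine ⟨f.restrictScalars B, fun i => ?_⟩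
      refine Fin.cases ?_ (fun j => ?_) i
      · simp [halg]
      · simpa using hf j

end Splitting

/-! ### The upper bound $n!$ from leading forms -/

section DegreeBound

open MvPolynomial

universe u

variable {K : Type u} [Field K] {n : ℕ}

/-- The ideal generated by the elementary symmetric polynomials of positive degree. -/
noncomputable def esymmIdeal (K : Type u) [Field K] (n : ℕ) : Ideal (MvPolynomial (Fin n) K) :=
  Ideal.span (esymm (Fin n) K '' Set.Icc 1 n)

theorem prod_X_sub_C_eq_X_pow_of_esymm {S : Type*} [CommRing S] [Algebra K S] (r : Fin n → S)
    (h : ∀ k ∈ Set.Icc 1 n, aeval r (esymm (Fin n) K k) = 0) :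
    ∏ i, (Polynomial.X - Polynomial.C (r i)) = Polynomial.X ^ n := by
  have hv := Multiset.prod_X_sub_X_eq_sum_esymm (Finset.univ.val.map r)
  rw [Multiset.map_map] at hv
  refine Eq.trans hv ?_
  rw [Multiset.card_map, Finset.card_val, Finset.card_univ, Fintype.card_fin,
    Finset.sum_eq_single 0]
  · simp [Multiset.esymm]
  · intro j hj hj0
    rw [← aeval_esymm_eq_multiset_esymm (Fin n) K, h j ⟨by omega, by simp at hj; omega⟩]
    simp
  · simp

/-- By Vieta, the classes of the variables split $X^n$ in the quotient, so the universal splitting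
algebra of $X^n$ maps onto it. -/
theorem finrank_quotient_esymmIdeal_le :
    Module.Finite K (MvPolynomial (Fin n) K ⧸ esymmIdeal K n) ∧
      Module.finrank K (MvPolynomial (Fin n) K ⧸ esymmIdeal K n) ≤ n.factorial := by
  obtain ⟨S, _, _, r, hS, hfree, hfin, hrank, hmap, hadj, huniv⟩ :=
    exists_universal_splitting_algebra n K (Polynomial.X ^ n) (Polynomial.monic_X_pow n)
      (Polynomial.natDegree_X_pow n)
  let v : Fin n → MvPolynomial (Fin n) K ⧸ esymmIdeal K n := fun i => Ideal.Quotient.mk _ (X i)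
  have haeval : aeval v = Ideal.Quotient.mkₐ K (esymmIdeal K n) := (mkₐ_eq_aeval _).symm
  obtain ⟨f, hf⟩ := huniv _ v (by
    rw [Polynomial.map_pow, Polynomial.map_X, prod_X_sub_C_eq_X_pow_of_esymm (K := K)]
    intro k hk
    rw [haeval]
    exact Ideal.Quotient.eq_zero_iff_mem.mpr (Ideal.subset_span ⟨k, hk, rfl⟩))
  have hsurj : Function.Surjective f := by
    intro q
    obtain ⟨p, rfl⟩ := Ideal.Quotient.mk_surjective q
    refine ⟨aeval r p, ?_⟩
    have : f.comp (aeval r) = aeval v := by ext i; simp [hf]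
    rw [← AlgHom.comp_apply, this, haeval]
    rfl
  refine ⟨Module.Finite.of_surjective f.toLinearMap hsurj, ?_⟩
  rw [← hrank]
  exact LinearMap.finrank_le_finrank_of_surjective (f := f.toLinearMap) hsurj

theorem mul_mem_restrictSupport_degree_lt {f g : MvPolynomial (Fin n) K} {a b : ℕ}
    (hf : f.IsHomogeneous a) (hg : g ∈ restrictSupport K {m : Fin n →₀ ℕ | m.degree < b}) :
    f * g ∈ restrictSupport K {m : Fin n →₀ ℕ | m.degree < a + b} := by
  classical
  rw [mem_restrictSupport_iff] at hg ⊢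
  intro m hm
  obtain ⟨x, hx, y, hy, rfl⟩ := Finset.mem_add.mp (support_mul f g hm)
  have h1 : x.degree = a := by
    have := hf (mem_support_iff.mp hx)
    rwa [Finsupp.degree_eq_weight_one]
  have h2 : y.degree < b := hg hy
  simp only [Set.mem_ofPred_eq, map_add]
  omega

theorem homogeneousComponent_mul_of_isHomogeneous {f g : MvPolynomial (Fin n) K} {k : ℕ}
    (hg : g.IsHomogeneous k) (d : ℕ) :
    homogeneousComponent d (f * g) =
      if k ≤ d then homogeneousComponent (d - k) f * g else 0 := by
  have hterm : ∀ i, homogeneousComponent d (homogeneousComponent i f * g) =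
      if d = i + k then homogeneousComponent i f * g else 0 := fun i =>
    homogeneousComponent_of_mem ((homogeneousComponent_isHomogeneous i f).mul hg)
  conv_lhs => rw [← sum_homogeneousComponent f, Finset.sum_mul, map_sum]
  simp_rw [hterm]
  split_ifs with h
  · rw [Finset.sum_eq_single (d - k)]
    · rw [if_pos (by omega)]
    · intro i _ hi
      rw [if_neg (by omega)]
    · intro hmem
      rw [homogeneousComponent_eq_zero _ _ (by simp at hmem; omega)]
      simp
  · exact Finset.sum_eq_zero fun i _ => if_neg (by omega)

theorem isHomogeneous_esymm (k : ℕ) : (esymm (Fin n) K k).IsHomogeneous k := by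
  refine IsHomogeneous.sum _ _ _ fun t ht => ?_
  have := IsHomogeneous.prod t (fun i => (X i : MvPolynomial (Fin n) K)) (fun _ => 1)
    fun i _ => isHomogeneous_X K i
  simpa [(Finset.mem_powersetCard.mp ht).2] using this

/-- A polynomial in the ideal of elementary symmetric polynomials has the same component in degree
`d` as some element of degree at most `d` of the ideal generated by perturbations of lower
degree. -/
theorem exists_mem_span_of_mem_esymmIdeal {p : ℕ → MvPolynomial (Fin n) K}
    (hp : ∀ k ∈ Set.Icc 1 n,
      esymm (Fin n) K k - p k ∈ restrictSupport K {m : Fin n →₀ ℕ | m.degree < k})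
    {h : MvPolynomial (Fin n) K} (hh : h ∈ esymmIdeal K n) (d : ℕ) :
    ∃ u ∈ Ideal.span (p '' Set.Icc 1 n),
      homogeneousComponent d h - u ∈ restrictSupport K {m : Fin n →₀ ℕ | m.degree < d} := by
  induction hh using Submodule.closure_induction with
  | zero => exact ⟨0, zero_mem _, by simp⟩
  | add x y _ _ hx hy =>
    obtain ⟨u, hu, hu'⟩ := hx
    obtain ⟨w, hw, hw'⟩ := hy
    refine ⟨u + w, add_mem hu hw, ?_⟩
    rw [map_add, add_sub_add_comm]
    exact add_mem hu' hw'
  | smul_mem a x hx =>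
    obtain ⟨k, hk, rfl⟩ := hx
    rw [smul_eq_mul, homogeneousComponent_mul_of_isHomogeneous (isHomogeneous_esymm k)]
    split_ifs with hkd
    -- Replacing $e_k$ by $p_k$ costs $a_{d-k}(e_k-p_k)$, of degree below $d$.
    · refine ⟨homogeneousComponent (d - k) a * p k,
        Ideal.mul_mem_left _ _ (Ideal.subset_span ⟨k, hk, rfl⟩), ?_⟩
      rw [← mul_sub]
      have := mul_mem_restrictSupport_degree_lt
        (homogeneousComponent_isHomogeneous (d - k) a) (hp k hk)
      rwa [Nat.sub_add_cancel hkd] at this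
    · exact ⟨0, zero_mem _, by simp⟩

theorem homogeneousComponent_mem_restrictSupport {s : Set (Fin n →₀ ℕ)}
    {w : MvPolynomial (Fin n) K}
    (hw : w ∈ restrictSupport K s) (d : ℕ) : homogeneousComponent d w ∈ restrictSupport K s := by
  rw [mem_restrictSupport_iff] at hw ⊢
  intro m hm
  rw [support_homogeneousComponent] at hm
  exact hw (Finset.mem_filter.mp hm).1

/-- If `p k` has leading form `esymm k`, then a set of monomials spanning the quotient by the
elementary symmetric polynomials also spans the quotient by the polynomials `p k`. -/
theorem mem_restrictSupport_sup_span {p : ℕ → MvPolynomial (Fin n) K}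
    (hp : ∀ k ∈ Set.Icc 1 n,
      esymm (Fin n) K k - p k ∈ restrictSupport K {m : Fin n →₀ ℕ | m.degree < k})
    {s : Set (Fin n →₀ ℕ)}
    (hs : restrictSupport K s ⊔ (esymmIdeal K n).restrictScalars K = ⊤)
    (d : ℕ) : ∀ f ∈ restrictSupport K {m : Fin n →₀ ℕ | m.degree < d},
      f ∈ restrictSupport K s ⊔ (Ideal.span (p '' Set.Icc 1 n)).restrictScalars K := by
  induction d with
  | zero =>
    intro f hf
    simp [mem_restrictSupport_iff] at hf
    simp [hf]
  | succ d ih =>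
    intro f hf
    obtain ⟨w, hw, h, hh, hfw⟩ := Submodule.mem_sup.mp
      (hs.symm ▸ Submodule.mem_top : f ∈ restrictSupport K s ⊔ (esymmIdeal K n).restrictScalars K)
    obtain ⟨u, hu, hu'⟩ := exists_mem_span_of_mem_esymmIdeal hp hh d
    have hlow : f - homogeneousComponent d f ∈
        restrictSupport K {m : Fin n →₀ ℕ | m.degree < d} := by
      rw [mem_restrictSupport_iff] at hf ⊢
      intro m hm
      have hm' := mem_support_iff.mp hm
      rw [coeff_sub, coeff_homogeneousComponent] at hm'
      split_ifs at hm' with hd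
      · simp at hm'
      · have : m.degree < d + 1 := hf (mem_support_iff.mpr (by simpa using hm'))
        exact lt_of_le_of_ne (by omega) hd
    -- Only the top component needs treatment: $f_d=w_d+h_d$, where $w_d$ stays in the span because
    -- that span is generated by monomials, and $h_d$ agrees with $u$ up to lower degree.
    have hdecomp : f = (f - homogeneousComponent d f + (homogeneousComponent d h - u))
        + (homogeneousComponent d w + u) := by
      rw [← hfw, map_add]; ring
    rw [hdecomp]
    exact add_mem (ih _ (add_mem hlow hu')) (add_mem
      (Submodule.mem_sup_left (homogeneousComponent_mem_restrictSupport hw d))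
      (Submodule.mem_sup_right hu))

/-- If each `p k`, `1 ≤ k ≤ n`, has leading form `esymm k`, then `p 1, …, p n` cut out an algebra
of dimension at most `n!`. -/
theorem finrank_quotient_span_le_factorial {p : ℕ → MvPolynomial (Fin n) K}
    (hp : ∀ k ∈ Set.Icc 1 n,
      esymm (Fin n) K k - p k ∈ restrictSupport K {m : Fin n →₀ ℕ | m.degree < k}) :
    Module.Finite K (MvPolynomial (Fin n) K ⧸ Ideal.span (p '' Set.Icc 1 n)) ∧
      Module.finrank K (MvPolynomial (Fin n) K ⧸ Ideal.span (p '' Set.Icc 1 n)) ≤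
        n.factorial := by
  obtain ⟨hfin, hle⟩ := finrank_quotient_esymmIdeal_le (K := K) (n := n)
  let π := (Ideal.Quotient.mkₐ K (esymmIdeal K n)).toLinearMap
  have hπ : Function.Surjective π := Ideal.Quotient.mk_surjective
  -- The basis is extracted from the monomials, so that its span is stable under homogeneous
  -- components.
  obtain ⟨κ, a, -, hsp, hli⟩ :=
    exists_linearIndependent' K (fun m : Fin n →₀ ℕ => π (monomial m 1))
  have hκ : Finite κ := hli.finite
  have : Fintype κ := Fintype.ofFinite κ
  have hcard : Fintype.card κ ≤ n.factorial := hli.fintype_card_le_finrank.trans hle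
  have hspan : ∀ g : κ → Fin n →₀ ℕ, restrictSupport K (Set.range g) =
      Submodule.span K (Set.range fun i => monomial (g i) (1 : K)) := fun g => by
    rw [restrictSupport_eq_span, ← Set.range_comp]; rfl
  have htop : restrictSupport K (Set.range a) ⊔ (esymmIdeal K n).restrictScalars K = ⊤ := by
    have hker : LinearMap.ker π = (esymmIdeal K n).restrictScalars K := by
      ext x
      exact Ideal.Quotient.eq_zero_iff_mem
    rw [← hker, ← LinearMap.map_eq_top_iff (LinearMap.range_eq_top.mpr hπ), hspan,
      Submodule.map_span, ← Set.range_comp]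
    refine hsp.trans ?_
    have : (fun m : Fin n →₀ ℕ => π (monomial m 1)) = π ∘ fun m => monomial m 1 := rfl
    rw [this, Set.range_comp, ← Submodule.map_span, ← Set.image_univ, ← restrictSupport_eq_span,
      restrictSupport_univ, Submodule.map_top, LinearMap.range_eq_top.mpr hπ]
  let ρ := (Ideal.Quotient.mkₐ K (Ideal.span (p '' Set.Icc 1 n))).toLinearMap
  have hρ : Submodule.span K (Set.range fun i => ρ (monomial (a i) 1)) = ⊤ := by
    rw [eq_top_iff]
    rintro x -
    obtain ⟨f, rfl⟩ := Ideal.Quotient.mk_surjective x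
    have hf : f ∈ restrictSupport K {m : Fin n →₀ ℕ | m.degree < f.totalDegree + 1} := by
      rw [mem_restrictSupport_iff]
      intro m hm
      exact Nat.lt_succ_of_le (le_totalDegree hm)
    obtain ⟨w, hw, u, hu, rfl⟩ := Submodule.mem_sup.mp
      (mem_restrictSupport_sup_span hp htop _ f hf)
    have hu0 : Ideal.Quotient.mk (Ideal.span (p '' Set.Icc 1 n)) u = 0 :=
      Ideal.Quotient.eq_zero_iff_mem.mpr hu
    rw [map_add, hu0, add_zero]
    rw [hspan] at hw
    have := Submodule.mem_map_of_mem (f := ρ) hw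
    rw [Submodule.map_span, ← Set.range_comp] at this
    exact this
  constructor
  · exact Module.finite_def.mpr (hρ ▸ Submodule.fg_span (Set.finite_range _))
  · rw [← finrank_top, ← hρ]
    exact (finrank_range_le_card _).trans hcard

end DegreeBound

/-! ### Local algebras and the length of a zero-dimensional scheme -/

section LocalMultiplicity

open MvPolynomial

variable {n : ℕ}

/-- The local algebra at `x` of the scheme cut out by `J`. -/
abbrev pointLocalAlgebra (J : Ideal (MvPolynomial (Fin n) ℂ)) (x : Fin n → ℂ) : Type :=
  Localization.AtPrime (pointIdeal x) ⧸
    J.map (algebraMap (MvPolynomial (Fin n) ℂ) (Localization.AtPrime (pointIdeal x)))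

/-- The canonical map from polynomials to the local algebra at `x`. -/
noncomputable def toPointLocalAlgebra (J : Ideal (MvPolynomial (Fin n) ℂ)) (x : Fin n → ℂ) :
    MvPolynomial (Fin n) ℂ →ₐ[ℂ] pointLocalAlgebra J x :=
  (Ideal.Quotient.mkₐ ℂ _).comp
    (IsScalarTower.toAlgHom ℂ (MvPolynomial (Fin n) ℂ) (Localization.AtPrime (pointIdeal x)))

theorem toPointLocalAlgebra_eq_zero {J : Ideal (MvPolynomial (Fin n) ℂ)} (x : Fin n → ℂ)
    {f : MvPolynomial (Fin n) ℂ} (hf : f ∈ J) : toPointLocalAlgebra J x f = 0 :=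
  Ideal.Quotient.eq_zero_iff_mem.mpr (Ideal.mem_map_of_mem _ hf)

theorem isUnit_toPointLocalAlgebra (J : Ideal (MvPolynomial (Fin n) ℂ)) {x : Fin n → ℂ}
    {f : MvPolynomial (Fin n) ℂ} (hf : f ∉ pointIdeal x) :
    IsUnit (toPointLocalAlgebra J x f) :=
  (IsLocalization.map_units (Localization.AtPrime (pointIdeal x))
    (⟨f, hf⟩ : (pointIdeal x).primeCompl)).map (Ideal.Quotient.mkₐ ℂ _)

/-- No denominators are needed: in the Artinian quotient $s^k=s^{k+1}g$ for some $g$, and since $s$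
becomes a unit locally, $g$ becomes its inverse. -/
theorem toPointLocalAlgebra_surjective (J : Ideal (MvPolynomial (Fin n) ℂ))
    [Module.Finite ℂ (MvPolynomial (Fin n) ℂ ⧸ J)] (x : Fin n → ℂ) :
    Function.Surjective (toPointLocalAlgebra J x) := by
  have hart : IsArtinianRing (MvPolynomial (Fin n) ℂ ⧸ J) := IsArtinianRing.of_finite ℂ _
  intro t
  obtain ⟨l, rfl⟩ := Ideal.Quotient.mk_surjective t
  obtain ⟨f, s, rfl⟩ := IsLocalization.exists_mk'_eq (pointIdeal x).primeCompl l
  have hs := isUnit_toPointLocalAlgebra J s.2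
  obtain ⟨k, y, hy⟩ := IsArtinian.exists_pow_succ_smul_dvd
    (Ideal.Quotient.mk J (s : MvPolynomial (Fin n) ℂ)) (1 : MvPolynomial (Fin n) ℂ ⧸ J)
  obtain ⟨g, rfl⟩ := Ideal.Quotient.mk_surjective y
  have hmem : (s : MvPolynomial (Fin n) ℂ) ^ (k + 1) * g - s ^ k ∈ J := by
    rw [← Ideal.Quotient.eq_zero_iff_mem, map_sub, sub_eq_zero]
    simpa using hy
  have h0 := toPointLocalAlgebra_eq_zero x hmem
  rw [map_sub, map_mul, map_pow, map_pow, sub_eq_zero, pow_succ, mul_assoc] at h0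
  have hsg : toPointLocalAlgebra J x s * toPointLocalAlgebra J x g = 1 :=
    (hs.pow k).mul_left_cancel (by rw [h0, mul_one])
  refine ⟨f * g, hs.mul_left_cancel ?_⟩
  have hsfg : toPointLocalAlgebra J x s * toPointLocalAlgebra J x (f * g) =
      toPointLocalAlgebra J x f := by
    rw [← map_mul, mul_left_comm, map_mul, map_mul, hsg, mul_one]
  refine hsfg.trans ?_
  have hmk := congrArg (Ideal.Quotient.mk (J.map (algebraMap (MvPolynomial (Fin n) ℂ)
    (Localization.AtPrime (pointIdeal x))))) (IsLocalization.mk'_spec'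
      (Localization.AtPrime (pointIdeal x)) f s)
  rw [map_mul] at hmk
  exact hmk.symm

theorem finite_pointLocalAlgebra (J : Ideal (MvPolynomial (Fin n) ℂ))
    [Module.Finite ℂ (MvPolynomial (Fin n) ℂ ⧸ J)] (x : Fin n → ℂ) :
    Module.Finite ℂ (pointLocalAlgebra J x) := by
  let f : MvPolynomial (Fin n) ℂ ⧸ J →ₐ[ℂ] pointLocalAlgebra J x :=
    Ideal.Quotient.liftₐ J (toPointLocalAlgebra J x) fun a ha => toPointLocalAlgebra_eq_zero x ha
  refine Module.Finite.of_surjective f.toLinearMap fun t => ?_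
  obtain ⟨g, rfl⟩ := toPointLocalAlgebra_surjective J x t
  exact ⟨Ideal.Quotient.mk J g, rfl⟩

theorem sub_C_constantCoeff_mem_idealOfVars (f : MvPolynomial (Fin n) ℂ) :
    f - C (constantCoeff f) ∈ idealOfVars (Fin n) ℂ := by
  rw [← pow_one (idealOfVars (Fin n) ℂ), mem_pow_idealOfVars_iff']
  intro m hm
  have : m = 0 := (Finsupp.degree_eq_zero_iff m).mp (by omega)
  simp [this, constantCoeff_eq]

/-- A quotient algebra in which all the variables are nilpotent bounds the multiplicity of the
origin from below. -/
theorem finrank_le_pointMultiplicity_zero (J : Ideal (MvPolynomial (Fin n) ℂ))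
    [Module.Finite ℂ (MvPolynomial (Fin n) ℂ ⧸ J)] {B : Type*} [CommRing B] [Algebra ℂ B]
    (f : MvPolynomial (Fin n) ℂ →ₐ[ℂ] B) (hf : Function.Surjective f)
    (hJ : ∀ g ∈ J, f g = 0) (hnil : ∀ i, IsNilpotent (f (X i))) :
    Module.finrank ℂ B ≤ pointMultiplicity J 0 := by
  -- A polynomial not vanishing at the origin maps to a unit plus a nilpotent, so `f` factors
  -- through the localization.
  have hunit : ∀ s : (pointIdeal (0 : Fin n → ℂ)).primeCompl, IsUnit (f s) := by
    rintro ⟨s, hs⟩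
    have hc : constantCoeff s ≠ 0 := by
      intro h
      apply hs
      change eval 0 s = 0
      rwa [eval_zero]
    have hle : idealOfVars (Fin n) ℂ ≤ (nilradical B).comap f := by
      rw [Ideal.span_le]
      rintro _ ⟨i, rfl⟩
      exact hnil i
    have hn : IsNilpotent (f (s - C (constantCoeff s))) :=
      hle (sub_C_constantCoeff_mem_idealOfVars s)
    have hcu : IsUnit (f (C (constantCoeff s))) :=
      ((isUnit_iff_ne_zero.mpr hc).map (C : ℂ →+* MvPolynomial (Fin n) ℂ)).map f
    have := hn.isUnit_add_left_of_commute hcu (Commute.all _ _)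
    rwa [← map_add, add_sub_cancel] at this
  let F : Localization.AtPrime (pointIdeal (0 : Fin n → ℂ)) →ₐ[ℂ] B :=
    IsLocalization.liftAlgHom (M := (pointIdeal (0 : Fin n → ℂ)).primeCompl) (f := f) hunit
  have hF : ∀ g, F (algebraMap _ _ g) = f g := fun g => IsLocalization.lift_eq _ g
  let G : pointLocalAlgebra J 0 →ₐ[ℂ] B := Ideal.Quotient.liftₐ _ F fun a ha => by
    have hle : J.map (algebraMap (MvPolynomial (Fin n) ℂ)
        (Localization.AtPrime (pointIdeal (0 : Fin n → ℂ)))) ≤ RingHom.ker F := by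
      rw [Ideal.map_le_iff_le_comap]
      intro g hg
      change F (algebraMap _ _ g) = 0
      rw [hF, hJ g hg]
    exact hle ha
  have := finite_pointLocalAlgebra J (0 : Fin n → ℂ)
  refine LinearMap.finrank_le_finrank_of_surjective (f := G.toLinearMap) fun b => ?_
  obtain ⟨g, rfl⟩ := hf b
  exact ⟨Ideal.Quotient.mk _ (algebraMap _ _ g), hF g⟩

theorem isCoprime_pointIdeal {x y : Fin n → ℂ} (h : x ≠ y) :
    IsCoprime (pointIdeal x) (pointIdeal y) := by
  obtain ⟨i, hi⟩ := Function.ne_iff.mp h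
  rw [Ideal.isCoprime_iff_exists]
  have hxy : y i - x i ≠ 0 := sub_ne_zero.mpr hi.symm
  refine ⟨C (y i - x i)⁻¹ * (X i - C (x i)), ?_, C (y i - x i)⁻¹ * (C (y i) - X i), ?_, ?_⟩
  · simp [pointIdeal, RingHom.mem_ker]
  · simp [pointIdeal, RingHom.mem_ker]
  · rw [← mul_add, sub_add_sub_cancel', ← C_sub, ← C_mul, inv_mul_cancel₀ hxy, C_1]

/-- If $x_i\ne y_i$, then $X_i-y_i$ is a unit at $x$ with inverse represented by a polynomial $g$,
and $1-(X_i-y_i)g$ dies in the local algebra. -/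
theorem isCoprime_ker_toPointLocalAlgebra (J : Ideal (MvPolynomial (Fin n) ℂ))
    [Module.Finite ℂ (MvPolynomial (Fin n) ℂ ⧸ J)] {x y : Fin n → ℂ} (h : x ≠ y) :
    IsCoprime (RingHom.ker (toPointLocalAlgebra J x)) (pointIdeal y) := by
  obtain ⟨i, hi⟩ := Function.ne_iff.mp h
  have hu : IsUnit (toPointLocalAlgebra J x (X i - C (y i))) := by
    apply isUnit_toPointLocalAlgebra
    simp [pointIdeal, RingHom.mem_ker, sub_eq_zero, hi]
  obtain ⟨t, ht⟩ := hu.exists_right_inv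
  obtain ⟨g, rfl⟩ := toPointLocalAlgebra_surjective J x t
  rw [Ideal.isCoprime_iff_exists]
  refine ⟨1 - (X i - C (y i)) * g, ?_, (X i - C (y i)) * g, ?_, by ring⟩
  · rw [RingHom.mem_ker, map_sub, map_mul, ht, map_one, sub_self]
  · exact Ideal.mul_mem_right _ _ (by simp [pointIdeal, RingHom.mem_ker])

/-- The multiplicity of one point plus the number of the other points of a zero-dimensional scheme
is at most its length. -/
theorem pointMultiplicity_add_card_le (J : Ideal (MvPolynomial (Fin n) ℂ))
    [Module.Finite ℂ (MvPolynomial (Fin n) ℂ ⧸ J)] (x : Fin n → ℂ)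
    (s : Finset (Fin n → ℂ)) (hs : ∀ y ∈ s, y ∈ zeroLocus ℂ J) (hx : x ∉ s) :
    pointMultiplicity J x + s.card ≤ Module.finrank ℂ (MvPolynomial (Fin n) ℂ ⧸ J) := by
  -- `none` carries the full local algebra at `x`; each other point contributes only its residue
  -- field.
  let q : Option s → Ideal (MvPolynomial (Fin n) ℂ) := fun o =>
    o.elim (RingHom.ker (toPointLocalAlgebra J x)) fun y => pointIdeal y.1
  have hne : ∀ y : s, x ≠ y.1 := fun y hy => hx (hy ▸ y.2)
  have hq : Pairwise (Function.onFun IsCoprime q) := by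
    rintro (_ | y) (_ | z) hyz
    · exact (hyz rfl).elim
    · exact isCoprime_ker_toPointLocalAlgebra J (hne z)
    · exact (isCoprime_ker_toPointLocalAlgebra J (hne y)).symm
    · exact isCoprime_pointIdeal fun h => hyz (congrArg some (Subtype.ext h))
  have hJq : ∀ o, J ≤ q o := by
    rintro (_ | y) g hg
    · exact toPointLocalAlgebra_eq_zero x hg
    · exact hs y y.2 g hg
  let Φ : (MvPolynomial (Fin n) ℂ ⧸ J) →ₗ[ℂ] (∀ o, MvPolynomial (Fin n) ℂ ⧸ q o) :=
    LinearMap.pi fun o => (Ideal.Quotient.factorₐ ℂ (hJq o)).toLinearMap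
  have hΦ : Function.Surjective Φ := by
    intro z
    obtain ⟨w, hw⟩ := Ideal.quotientInfToPiQuotient_surj hq z
    obtain ⟨g, rfl⟩ := Ideal.Quotient.mk_surjective w
    exact ⟨Ideal.Quotient.mk J g, hw⟩
  have hfin : ∀ o, Module.Finite ℂ (MvPolynomial (Fin n) ℂ ⧸ q o) := fun o =>
    Module.Finite.of_surjective (Ideal.Quotient.factorₐ ℂ (hJq o)).toLinearMap
      (Ideal.Quotient.factor_surjective (hJq o))
  have hrank := LinearMap.finrank_le_finrank_of_surjective hΦ
  rw [Module.finrank_pi_fintype, Fintype.sum_option] at hrank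
  refine le_trans (add_le_add ?_ ?_) hrank
  · exact ((Ideal.quotientKerAlgEquivOfSurjective
      (toPointLocalAlgebra_surjective J x)).toLinearEquiv.finrank_eq).ge
  · calc s.card = ∑ _y : s, 1 := by simp
      _ ≤ _ := Finset.sum_le_sum fun y _ => by
        have : Nontrivial (MvPolynomial (Fin n) ℂ ⧸ q (some y)) :=
          Ideal.Quotient.nontrivial_iff.mpr (pointIdeal_isPrime y.1).ne_top
        exact Module.finrank_pos

end LocalMultiplicity

/-! ### Determinants of Floquet matrices -/

section FloquetDeterminant

open Polynomial

theorem floquetCharpoly_fin_three {R : Type*} [CommRing R]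
    (v : Fin 3 → R) :
    floquetCharpoly v = (C (v 0) - X) * (C (v 1) - X) * (C (v 2) - X)
      - (C (v 0) - X) - (C (v 1) - X) - (C (v 2) - X) + 2 := by
  rw [floquetCharpoly, Matrix.det_fin_three]
  simp [floquetMatrix]
  ring

theorem floquetCharpoly_fin_four {R : Type*} [CommRing R]
    (v : Fin 4 → R) :
    floquetCharpoly v = (C (v 0) - X) * (C (v 1) - X) * (C (v 2) - X) * (C (v 3) - X)
      - (C (v 0) - X) * (C (v 1) - X) - (C (v 1) - X) * (C (v 2) - X)
      - (C (v 2) - X) * (C (v 3) - X) - (C (v 3) - X) * (C (v 0) - X) := by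
  rw [floquetCharpoly, Matrix.det_succ_row_zero]
  simp [floquetMatrix, Matrix.diagonal_apply, Fin.sum_univ_succ, Matrix.det_fin_three,
    Fin.succAbove]
  ring

theorem floquetMatrix_map {R S : Type*} [CommRing R] [CommRing S]
    (f : R →+* S) {n : ℕ} (v : Fin n → R) :
    (floquetMatrix v 1).map f = floquetMatrix (f ∘ v) 1 := by
  ext i j
  simp [floquetMatrix, apply_ite f]

theorem floquetCharpoly_map {R S : Type*} [CommRing R] [CommRing S]
    (f : R →+* S) {n : ℕ} (v : Fin n → R) :
    (floquetCharpoly v).map f = floquetCharpoly (f ∘ v) := by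
  rw [floquetCharpoly, floquetCharpoly, ← coe_mapRingHom, RingHom.map_det, ← floquetMatrix_map]
  congr 1
  ext i j : 2
  simp [Matrix.diagonal_apply, apply_ite]

theorem floquetMatrix_apply_self {R : Type*} [CommRing R]
    {n : ℕ} (hn : 2 < n) (v : Fin n → R) (i : Fin n) :
    floquetMatrix v 1 i i = v i := by
  simp [floquetMatrix]
  grind

theorem floquetMatrix_apply_of_ne {R : Type*} [CommRing R]
    {n : ℕ} (v w : Fin n → R) {i j : Fin n} (h : i ≠ j) :
    floquetMatrix v 1 i j = floquetMatrix w 1 i j := by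
  simp [floquetMatrix, h]

/-- At $z=1$ the off-diagonal pattern is a cycle, so rotating the potential conjugates the matrix by
a permutation. -/
theorem floquetCharpoly_comp_finRotate {R : Type*} [CommRing R]
    {n : ℕ} (hn : 2 < n) (v : Fin n → R) :
    floquetCharpoly (v ∘ finRotate n) = floquetCharpoly v := by
  obtain ⟨n, rfl⟩ : ∃ m, n = m + 1 := ⟨n - 1, by omega⟩
  have key : floquetMatrix (v ∘ finRotate (n + 1)) 1 =
      (floquetMatrix v 1).submatrix (finRotate (n + 1)) (finRotate (n + 1)) := by
    have hval : ∀ i : Fin (n + 1), ((finRotate (n + 1) i : Fin (n + 1)) : ℕ) =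
        if (i : ℕ) = n then 0 else (i : ℕ) + 1 := by
      intro i
      rw [coe_finRotate]
      simp [Fin.ext_iff]
    ext i j
    simp only [floquetMatrix, Matrix.of_apply, Matrix.submatrix_apply, Function.comp_apply,
      EmbeddingLike.apply_eq_iff_eq, hval, inv_one, Units.val_one]
    have hi := i.2
    have hj := j.2
    clear hval
    generalize (i : ℕ) = a at *
    generalize (j : ℕ) = b at *
    by_cases ha : a = n <;> by_cases hb : b = n <;> grind
  rw [floquetCharpoly, floquetCharpoly, key,
    ← Matrix.det_submatrix_equiv_self (finRotate (n + 1)) ((floquetMatrix v 1).map C - _)]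
  congr 1
  ext i j : 2
  simp [Matrix.diagonal_apply]

end FloquetDeterminant

/-! ### Leading forms and linear parts of the spectral invariants -/

section SpectralInvariants

open MvPolynomial

variable {n : ℕ}

/-- Polynomials in `λ` over `ℂ[v]` all of whose terms `v ^ m λ ^ j` satisfy `|m| + j ≤ d`. -/
def jointDegreeLE (n d : ℕ) : AddSubgroup (Polynomial (MvPolynomial (Fin n) ℂ)) where
  carrier := {P | ∀ j m, coeff m (P.coeff j) ≠ 0 → m.degree + j ≤ d}
  zero_mem' := by simp
  add_mem' := by
    intro P Q hP hQ j m h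
    rw [Polynomial.coeff_add, coeff_add] at h
    by_cases hp : coeff m (P.coeff j) = 0
    · rw [hp, zero_add] at h
      exact hQ j m h
    · exact hP j m hp
  neg_mem' := by
    intro P hP j m h
    rw [Polynomial.coeff_neg, coeff_neg, neg_ne_zero] at h
    exact hP j m h

theorem jointDegreeLE_mono {d e : ℕ} (h : d ≤ e) : jointDegreeLE n d ≤ jointDegreeLE n e :=
  fun _ hP j m hm => (hP j m hm).trans h

theorem mul_mem_jointDegreeLE {d e : ℕ} {P Q : Polynomial (MvPolynomial (Fin n) ℂ)}
    (hP : P ∈ jointDegreeLE n d) (hQ : Q ∈ jointDegreeLE n e) :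
    P * Q ∈ jointDegreeLE n (d + e) := by
  classical
  intro j m h
  rw [Polynomial.coeff_mul, coeff_sum] at h
  obtain ⟨⟨a, b⟩, hab, h⟩ := Finset.exists_ne_zero_of_sum_ne_zero h
  rw [coeff_mul] at h
  obtain ⟨⟨x, y⟩, hxy, h⟩ := Finset.exists_ne_zero_of_sum_ne_zero h
  have h1 := hP a x (left_ne_zero_of_mul h)
  have h2 := hQ b y (right_ne_zero_of_mul h)
  rw [Finset.HasAntidiagonal.mem_antidiagonal] at hab hxy
  simp only at hab hxy
  rw [← hab, ← hxy, map_add]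
  omega

theorem C_C_mem_jointDegreeLE (c : ℂ) (d : ℕ) :
    Polynomial.C (C c) ∈ jointDegreeLE n d := by
  classical
  intro j m h
  rw [Polynomial.coeff_C] at h
  split_ifs at h with hj
  · rw [coeff_C] at h
    split_ifs at h with hm
    · simp [← hm, hj]
    · simp at h
  · simp at h

theorem prod_mem_jointDegreeLE {ι : Type*} (s : Finset ι) (d : ι → ℕ)
    (P : ι → Polynomial (MvPolynomial (Fin n) ℂ)) (hP : ∀ i ∈ s, P i ∈ jointDegreeLE n (d i)) :
    ∏ i ∈ s, P i ∈ jointDegreeLE n (∑ i ∈ s, d i) := by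
  classical
  induction s using Finset.induction_on with
  | empty => simpa using C_C_mem_jointDegreeLE (n := n) 1 0
  | insert a s ha ih =>
    rw [Finset.prod_insert ha, Finset.sum_insert ha]
    exact mul_mem_jointDegreeLE (hP a (Finset.mem_insert_self a s))
      (ih fun i hi => hP i (Finset.mem_insert_of_mem hi))

theorem C_X_sub_X_mem_jointDegreeLE (i : Fin n) :
    Polynomial.C (X i) - Polynomial.X ∈ jointDegreeLE n 1 := by
  classical
  refine sub_mem ?_ ?_
  · intro j m h
    rw [Polynomial.coeff_C] at h
    split_ifs at h with hj
    · rw [coeff_X] at h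
      split_ifs at h with hm
      · simp [← hm, hj]
      · simp at h
    · simp at h
  · intro j m h
    rw [Polynomial.coeff_X] at h
    split_ifs at h with hj
    · rw [coeff_one] at h
      split_ifs at h with hm
      · simp [← hm, ← hj]
      · simp at h
    · simp at h

/-- In the Leibniz expansion a nonidentity permutation uses at most $n-1$ diagonal entries, and
off-diagonal entries are constants. Hence these terms contribute degree below $k$ to the coefficient
of $\lambda^{n-k}$. -/
theorem floquetCharpoly_sub_prod_mem_jointDegreeLE (hn : 2 < n) :
    floquetCharpoly (fun i : Fin n => (X i : MvPolynomial (Fin n) ℂ))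
      - ∏ i, (Polynomial.C (X i) - Polynomial.X) ∈ jointDegreeLE n (n - 1) := by
  classical
  set M := (floquetMatrix (fun i : Fin n => (X i : MvPolynomial (Fin n) ℂ)) 1).map Polynomial.C
    - Matrix.scalar (Fin n) Polynomial.X with hM
  have hdiag : ∀ i, M i i = Polynomial.C (X i) - Polynomial.X := fun i => by
    simp [hM, floquetMatrix_apply_self hn]
  have hoff : ∀ i j, i ≠ j → M i j ∈ jointDegreeLE n 0 := fun i j hij => by
    have h0 := congrFun (congrFun
      (floquetMatrix_map (C : ℂ →+* MvPolynomial (Fin n) ℂ) (0 : Fin n → ℂ)) i) j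
    have : M i j = Polynomial.C (C (floquetMatrix (0 : Fin n → ℂ) 1 i j)) := by
      rw [Matrix.map_apply] at h0
      rw [h0]
      simp [hM, hij, floquetMatrix_apply_of_ne _ (C ∘ (0 : Fin n → ℂ)) hij]
    rw [this]
    exact C_C_mem_jointDegreeLE _ _
  have hdet : floquetCharpoly (fun i : Fin n => (X i : MvPolynomial (Fin n) ℂ)) = M.det := rfl
  rw [hdet, Matrix.det_apply, ← Finset.add_sum_erase _ _ (Finset.mem_univ (1 : Equiv.Perm (Fin n)))]
  simp only [Equiv.Perm.sign_one, one_smul, Equiv.Perm.one_apply, hdiag, add_sub_cancel_left]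
  refine sum_mem fun σ hσ => ?_
  rw [Units.smul_def]
  refine zsmul_mem ?_ _
  have hP := prod_mem_jointDegreeLE Finset.univ (fun i => if σ i = i then 1 else 0)
    (fun i => M (σ i) i) fun i _ => by
      split_ifs with h
      · rw [h, hdiag]
        exact C_X_sub_X_mem_jointDegreeLE i
      · exact hoff _ _ h
  refine jointDegreeLE_mono ?_ hP
  obtain ⟨i, hi⟩ : ∃ i, σ i ≠ i := by
    by_contra! h
    exact (Finset.mem_erase.mp hσ).1 (Equiv.ext h)
  rw [← Finset.card_filter]
  have hlt : (Finset.univ.filter fun i => σ i = i).card < (Finset.univ : Finset (Fin n)).card :=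
    Finset.card_lt_card (Finset.filter_ssubset.mpr ⟨i, Finset.mem_univ i, hi⟩)
  rw [Finset.card_univ, Fintype.card_fin] at hlt
  omega

theorem coeff_prod_C_sub_X {k : ℕ} (hk : k ≤ n) :
    (∏ i : Fin n, (Polynomial.C (X i : MvPolynomial (Fin n) ℂ) - Polynomial.X)).coeff (n - k) =
      (-1) ^ (n - k) * esymm (Fin n) ℂ k := by
  have h : ∏ i : Fin n, (Polynomial.C (X i : MvPolynomial (Fin n) ℂ) - Polynomial.X) =
      (∏ i : Fin n, (Polynomial.X + Polynomial.C (X i : MvPolynomial (Fin n) ℂ))).comp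
        (-Polynomial.X) := by
    rw [Polynomial.prod_comp]
    refine Finset.prod_congr rfl fun i _ => ?_
    simp
    ring
  have hneg : (-Polynomial.X : Polynomial (MvPolynomial (Fin n) ℂ)) =
      Polynomial.C (-1) * Polynomial.X := by
    rw [Polynomial.C_neg, Polynomial.C_1]
    ring
  rw [h, hneg, Polynomial.comp_C_mul_X_coeff, MvPolynomial.prod_X_add_C_coeff _ _ _ (by simp),
    Fintype.card_fin, Nat.sub_sub_self hk, mul_comm]

theorem floquetCharpoly_zero_eq_map :
    floquetCharpoly (fun _ : Fin n => (0 : MvPolynomial (Fin n) ℂ)) =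
      (floquetCharpoly (0 : Fin n → ℂ)).map C := by
  rw [floquetCharpoly_map]
  congr 1
  ext i : 1
  simp

/-- The leading form of the spectral invariant `p_k` is the elementary symmetric polynomial. -/
theorem esymm_sub_spectralInvariant_mem (hn : 2 < n) {k : ℕ} (hk : k ∈ Set.Icc 1 n) :
    esymm (Fin n) ℂ k - spectralInvariant n k ∈
      restrictSupport ℂ {m : Fin n →₀ ℕ | m.degree < k} := by
  classical
  obtain ⟨hk1, hkn⟩ := hk
  have hsq : ((-1 : MvPolynomial (Fin n) ℂ) ^ (n - k)) * (-1) ^ (n - k) = 1 := by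
    rw [← mul_pow]; simp
  have hlow := floquetCharpoly_sub_prod_mem_jointDegreeLE hn
  set D := floquetCharpoly (fun i : Fin n => (X i : MvPolynomial (Fin n) ℂ)) with hD
  have hdecomp : esymm (Fin n) ℂ k - spectralInvariant n k = (-1) ^ (n - k) *
      ((C ((floquetCharpoly (0 : Fin n → ℂ)).coeff (n - k))) -
        (D - ∏ i, (Polynomial.C (X i) - Polynomial.X)).coeff (n - k)) := by
    rw [spectralInvariant, zetaPoly, floquetCharpoly_zero_eq_map, Polynomial.coeff_sub,
      Polynomial.coeff_sub, coeff_prod_C_sub_X hkn, Polynomial.coeff_map]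
    linear_combination (-esymm (Fin n) ℂ k) * hsq
  have hmem : (C ((floquetCharpoly (0 : Fin n → ℂ)).coeff (n - k))) -
      (D - ∏ i, (Polynomial.C (X i) - Polynomial.X)).coeff (n - k) ∈
        restrictSupport ℂ {m : Fin n →₀ ℕ | m.degree < k} := by
    refine sub_mem ?_ ?_
    -- The coefficient of $D_{\mathbf 0}$ is a constant, of degree $0<k$ because $k\ge1$.
    · rw [mem_restrictSupport_iff]
      intro m hm
      have hm' := mem_support_iff.mp hm
      rw [coeff_C] at hm'
      split_ifs at hm' with h0
      · rw [← h0]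
        simpa using Nat.lt_of_succ_le hk1
      · simp at hm'
    · rw [mem_restrictSupport_iff]
      intro m hm
      have := hlow (n - k) m (mem_support_iff.mp hm)
      change m.degree < k
      omega
  rw [hdecomp]
  rcases neg_one_pow_eq_or (MvPolynomial (Fin n) ℂ) (n - k) with h | h <;> rw [h]
  · rwa [one_mul]
  · rw [neg_one_mul]
    exact neg_mem hmem

theorem map_spectralInvariant {S : Type*} [CommRing S] (f : MvPolynomial (Fin n) ℂ →+* S)
    (k : ℕ) : f (spectralInvariant n k) =
      (-1) ^ (n - k) * (floquetCharpoly (fun i => f (X i)) -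
        floquetCharpoly (0 : Fin n → S)).coeff (n - k) := by
  have h0 : f ∘ (fun _ : Fin n => 0) = 0 := by ext i; simp
  rw [spectralInvariant, zetaPoly, map_mul, map_pow, map_neg, map_one, ← Polynomial.coeff_map,
    Polynomial.map_sub, floquetCharpoly_map, floquetCharpoly_map, h0]
  rfl

theorem constantCoeff_spectralInvariant (k : ℕ) :
    constantCoeff (spectralInvariant n k) = 0 := by
  rw [map_spectralInvariant]
  have : (fun i : Fin n => constantCoeff (X i : MvPolynomial (Fin n) ℂ)) = 0 := by ext i; simp
  rw [this, sub_self, Polynomial.coeff_zero, mul_zero]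

theorem rename_finRotate_spectralInvariant (hn : 2 < n) (k : ℕ) :
    rename (finRotate n) (spectralInvariant n k) = spectralInvariant n k := by
  have h := map_spectralInvariant (n := n) (rename (R := ℂ) (finRotate n)).toRingHom k
  have h' := map_spectralInvariant (n := n) (RingHom.id _) k
  refine h.trans (Eq.trans ?_ h'.symm)
  have hX : (fun i : Fin n => (rename (R := ℂ) (finRotate n)).toRingHom (X i)) =
      (fun i : Fin n => (X i : MvPolynomial (Fin n) ℂ)) ∘ finRotate n := by
    ext i : 1
    simp
  rw [hX, floquetCharpoly_comp_finRotate hn]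
  rfl

/-- The invariants are fixed by rotation, which permutes the variables transitively. -/
theorem coeff_single_spectralInvariant (hn : 2 < n) (k : ℕ) (i j : Fin n) :
    coeff (Finsupp.single i 1) (spectralInvariant n k) =
      coeff (Finsupp.single j 1) (spectralInvariant n k) := by
  have hstep : ∀ i, coeff (Finsupp.single (finRotate n i) 1) (spectralInvariant n k) =
      coeff (Finsupp.single i 1) (spectralInvariant n k) := fun i => by
    have := coeff_rename_mapDomain (finRotate n) (finRotate n).injective
      (spectralInvariant n k) (Finsupp.single i 1)
    rwa [rename_finRotate_spectralInvariant hn, Finsupp.mapDomain_single] at this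
  have hzero : ∀ m (hm : m < n), coeff (Finsupp.single ⟨m, hm⟩ 1) (spectralInvariant n k) =
      coeff (Finsupp.single ⟨0, by omega⟩ 1) (spectralInvariant n k) := by
    intro m
    induction m with
    | zero => intro _; rfl
    | succ m ih =>
      intro hm
      rw [← ih (by omega), ← hstep ⟨m, by omega⟩]
      congr 2
      obtain ⟨n, rfl⟩ : ∃ n', n = n' + 1 := ⟨n - 1, by omega⟩
      rw [finRotate_of_lt (by omega)]
  rw [hzero i i.2, hzero j j.2]

/-- Up to terms of order at least two, each spectral invariant is a multiple of `∑ v_i`. -/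
theorem exists_spectralInvariant_sub_mem_sq (hn : 2 < n) (k : ℕ) :
    ∃ c : ℂ, spectralInvariant n k - C c * esymm (Fin n) ℂ 1 ∈ idealOfVars (Fin n) ℂ ^ 2 := by
  classical
  refine ⟨coeff (Finsupp.single ⟨0, by omega⟩ 1) (spectralInvariant n k), ?_⟩
  rw [mem_pow_idealOfVars_iff']
  intro m hm
  rw [coeff_sub, coeff_C_mul, esymm_one, coeff_sum]
  interval_cases h : m.degree
  · have : m = 0 := (Finsupp.degree_eq_zero_iff m).mp h
    subst this
    have := constantCoeff_spectralInvariant (n := n) k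
    rw [constantCoeff_eq] at this
    simp [this]
  · obtain ⟨i, rfl⟩ : ∃ i, m = Finsupp.single i 1 := by
      obtain ⟨i, hi⟩ : ∃ i, m i ≠ 0 := by
        by_contra! h0
        rw [show m = 0 from Finsupp.ext h0, map_zero] at h
        exact zero_ne_one h
      obtain ⟨c, rfl⟩ := le_iff_exists_add.mp
        (Finsupp.single_le_iff.mpr (Nat.one_le_iff_ne_zero.mpr hi))
      rw [map_add, Finsupp.degree_single, add_eq_left, Finsupp.degree_eq_zero_iff] at h
      exact ⟨i, by rw [h, add_zero]⟩
    rw [coeff_single_spectralInvariant hn k i ⟨0, by omega⟩]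
    simp [coeff_X, Finsupp.single_left_inj]

theorem spectralInvariant_one (hn : 2 < n) : spectralInvariant n 1 = esymm (Fin n) ℂ 1 := by
  have h := esymm_sub_spectralInvariant_mem hn (k := 1) ⟨le_rfl, by omega⟩
  rw [mem_restrictSupport_iff] at h
  refine (sub_eq_zero.mp ?_).symm
  ext m
  by_contra hne
  have hm : m.degree < 1 := h (mem_support_iff.mpr hne)
  have : m = 0 := (Finsupp.degree_eq_zero_iff m).mp (by omega)
  subst this
  apply hne
  rw [← constantCoeff_eq, map_sub, constantCoeff_spectralInvariant, esymm_one]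
  simp

/-- There is no quadratic part here, which saves the one dimension missing from the general count
for $n=4$. -/
theorem spectralInvariant_four_three :
    spectralInvariant 4 3 = esymm (Fin 4) ℂ 3 - C 2 * esymm (Fin 4) ℂ 1 := by
  have hC2 : (Polynomial.C 2 : Polynomial (MvPolynomial (Fin 4) ℂ)) = 2 := map_ofNat _ 2
  have hC4 : (Polynomial.C 4 : Polynomial (MvPolynomial (Fin 4) ℂ)) = 4 := map_ofNat _ 4
  have hc2 : (C 2 : MvPolynomial (Fin 4) ℂ) = 2 := map_ofNat _ 2
  have hD : floquetCharpoly (fun i : Fin 4 => (X i : MvPolynomial (Fin 4) ℂ)) =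
      ∏ i : Fin 4, (Polynomial.C (X i : MvPolynomial (Fin 4) ℂ) - Polynomial.X) +
      (Polynomial.C (-(X 0 * X 1 + X 1 * X 2 + X 2 * X 3 + X 3 * X 0)) +
        Polynomial.C (2 * (X 0 + X 1 + X 2 + X 3)) * Polynomial.X -
          Polynomial.C 4 * Polynomial.X ^ 2) := by
    rw [floquetCharpoly_fin_four, Fin.prod_univ_four]
    simp only [map_neg, map_add, map_mul, hC2, hC4]
    ring
  have hD0 : floquetCharpoly (fun _ : Fin 4 => (0 : MvPolynomial (Fin 4) ℂ)) =
      Polynomial.X ^ 4 - Polynomial.C 4 * Polynomial.X ^ 2 := by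
    rw [floquetCharpoly_fin_four, hC4, map_zero]
    ring
  have h3 := coeff_prod_C_sub_X (n := 4) (k := 3) (by norm_num)
  rw [show 4 - 3 = 1 from rfl] at h3
  rw [spectralInvariant, zetaPoly, hD, hD0, show 4 - 3 = 1 from rfl, Polynomial.coeff_sub,
    Polynomial.coeff_add, h3, Polynomial.coeff_sub, Polynomial.coeff_add, Polynomial.coeff_C_mul_X,
    Polynomial.coeff_C_of_ne_zero one_ne_zero, Polynomial.coeff_C_mul_X_pow, Polynomial.coeff_sub,
    Polynomial.coeff_C_mul_X_pow, Polynomial.coeff_X_pow, esymm_one, Fin.sum_univ_four, hc2]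
  simp
  ring

end SpectralInvariants

/-! ### The multiplicity of the origin -/

section LowerBound

open MvPolynomial

variable {n : ℕ}

theorem esymm_mem_pow_idealOfVars (k : ℕ) : esymm (Fin n) ℂ k ∈ idealOfVars (Fin n) ℂ ^ k := by
  rw [mem_pow_idealOfVars_iff]
  intro m hm
  have := isHomogeneous_esymm k (mem_support_iff.mp hm)
  rw [Finsupp.degree_eq_weight_one]
  exact this.ge

/-- The exponents of the monomials of degree at most two in `n` variables. -/
def quadraticExponents (n : ℕ) : Finset (Fin n →₀ ℕ) :=
  (Finset.range 3).biUnion fun d => Finset.univ.finsuppAntidiag d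

theorem mem_quadraticExponents {m : Fin n →₀ ℕ} : m ∈ quadraticExponents n ↔ m.degree < 3 := by
  simp [quadraticExponents, Finset.mem_finsuppAntidiag, Finsupp.degree_eq_sum]

theorem card_quadraticExponents : (quadraticExponents n).card = 1 + n + (n + 1).choose 2 := by
  rw [quadraticExponents, Finset.card_biUnion]
  · simp [Finset.sum_range_succ, Finset.card_finsuppAntidiag_nat_eq_choose]
  · intro a _ b _ hab
    rw [Function.onFun, Finset.disjoint_left]
    intro m ha hb
    rw [Finset.mem_finsuppAntidiag] at ha hb
    exact hab (ha.1.symm.trans hb.1)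

/-- The coefficients of a polynomial in degrees at most two. -/
noncomputable def quadraticPart (n : ℕ) :
    MvPolynomial (Fin n) ℂ →ₗ[ℂ] (quadraticExponents n → ℂ) :=
  LinearMap.pi fun m => lcoeff ℂ m.1

theorem quadraticPart_surjective : Function.Surjective (quadraticPart n) := by
  classical
  intro g
  refine ⟨∑ m, monomial m.1 (g m), ?_⟩
  ext m
  change coeff m.1 (∑ m, monomial m.1 (g m)) = g m
  rw [coeff_sum, Finset.sum_eq_single m]
  · rw [coeff_monomial, if_pos rfl]
  · intro b _ hb
    rw [coeff_monomial, if_neg fun h => hb (Subtype.ext h)]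
  · exact fun h => (h (Finset.mem_univ m)).elim

theorem quadraticPart_eq_zero {f : MvPolynomial (Fin n) ℂ}
    (hf : f ∈ idealOfVars (Fin n) ℂ ^ 3) : quadraticPart n f = 0 := by
  ext m
  exact (mem_pow_idealOfVars_iff' 3 f).mp hf m.1 (mem_quadraticExponents.mp m.2)

/-- Modulo order three, a multiplier acts on a polynomial of order at least two through its constant
term alone, so ideal generation becomes linear span. -/
theorem quadraticPart_mem_span {s : Set (MvPolynomial (Fin n) ℂ)}
    (hs : ∀ g ∈ s, g ∈ idealOfVars (Fin n) ℂ ^ 2) {f : MvPolynomial (Fin n) ℂ}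
    (hf : f ∈ Ideal.span s) : quadraticPart n f ∈ Submodule.span ℂ (quadraticPart n '' s) := by
  induction hf using Submodule.closure_induction with
  | zero => simp
  | add x y _ _ hx hy =>
    rw [map_add]
    exact add_mem hx hy
  | smul_mem r g hg =>
    have h3 : (r - C (constantCoeff r)) * g ∈ idealOfVars (Fin n) ℂ ^ 3 := by
      rw [pow_succ']
      exact Ideal.mul_mem_mul (sub_C_constantCoeff_mem_idealOfVars r) (hs g hg)
    have heq : quadraticPart n (r • g) = constantCoeff r • quadraticPart n g := by
      rw [← map_smul, ← sub_eq_zero, ← map_sub, smul_eq_mul, smul_eq_C_mul, ← sub_mul]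
      exact quadraticPart_eq_zero h3
    rw [heq]
    exact Submodule.smul_mem _ _ (Submodule.subset_span ⟨g, hg, rfl⟩)

/-- If, modulo terms of order three, an ideal is generated by `∑ v_i` and the quadratic polynomials
in `G`, then the multiplicity of the origin is at least `n (n + 1) / 2 - |G|`. -/
theorem choose_le_pointMultiplicity_add_card (J : Ideal (MvPolynomial (Fin n) ℂ))
    [Module.Finite ℂ (MvPolynomial (Fin n) ℂ ⧸ J)] (G : Finset (MvPolynomial (Fin n) ℂ))
    (hG : ∀ g ∈ G, g ∈ idealOfVars (Fin n) ℂ ^ 2)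
    (hJ : J ≤ Ideal.span {esymm (Fin n) ℂ 1} ⊔ Ideal.span (G : Set (MvPolynomial (Fin n) ℂ)) ⊔
      idealOfVars (Fin n) ℂ ^ 3) :
    (n + 1).choose 2 ≤ pointMultiplicity J 0 + G.card := by
  classical
  set e := esymm (Fin n) ℂ 1 with he
  have he1 : e ∈ idealOfVars (Fin n) ℂ := by
    have := esymm_mem_pow_idealOfVars (n := n) 1
    rwa [pow_one] at this
  -- Up to order two, multiples of `e` are spanned by `e` and the `X i * e`; these $1+n$ vectors
  -- offset the $1+n$ monomials of degree at most one.
  let G' : Finset (MvPolynomial (Fin n) ℂ) := (Finset.univ.image fun i => X i * e) ∪ G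
  have hG' : ∀ g ∈ (G' : Set (MvPolynomial (Fin n) ℂ)), g ∈ idealOfVars (Fin n) ℂ ^ 2 := by
    intro g hg
    rcases Finset.mem_union.mp (Finset.mem_coe.mp hg) with hg | hg
    · obtain ⟨i, -, rfl⟩ := Finset.mem_image.mp hg
      rw [pow_two]
      exact Ideal.mul_mem_mul (Ideal.subset_span ⟨i, rfl⟩) he1
    · exact hG g hg
  let T : Finset (quadraticExponents n → ℂ) := (insert e G').image (quadraticPart n)
  have hT : T.card ≤ 1 + n + G.card := by
    refine Finset.card_image_le.trans ((Finset.card_insert_le _ _).trans ?_)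
    have h1 : G'.card ≤ n + G.card := (Finset.card_union_le _ _).trans
      (Nat.add_le_add_right (Finset.card_image_le.trans (by simp)) _)
    omega
  let N := Submodule.span ℂ (T : Set (quadraticExponents n → ℂ))
  have hG'N : Submodule.span ℂ (quadraticPart n '' (G' : Set (MvPolynomial (Fin n) ℂ))) ≤ N :=
    Submodule.span_mono fun x ⟨g, hg, hx⟩ =>
      Finset.mem_image.mpr ⟨g, Finset.mem_insert_of_mem hg, hx⟩
  have heN : quadraticPart n e ∈ N :=
    Submodule.subset_span (Finset.mem_image_of_mem _ (Finset.mem_insert_self e G'))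
  let J' := J ⊔ idealOfVars (Fin n) ℂ ^ 3
  have hJ' : ∀ f ∈ J', quadraticPart n f ∈ N := by
    intro f hf
    obtain ⟨f', hf', h, hh, rfl⟩ := Submodule.mem_sup.mp (sup_le hJ le_sup_right hf)
    obtain ⟨x, hx, b, hb, rfl⟩ := Submodule.mem_sup.mp hf'
    obtain ⟨a, rfl⟩ := Ideal.mem_span_singleton'.mp hx
    have hae : (a - C (constantCoeff a)) * e ∈
        Ideal.span (G' : Set (MvPolynomial (Fin n) ℂ)) := by
      have hle : idealOfVars (Fin n) ℂ ≤
          Submodule.comap (LinearMap.mulRight (MvPolynomial (Fin n) ℂ) e)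
            (Ideal.span (G' : Set (MvPolynomial (Fin n) ℂ))) := by
        rw [idealOfVars, Ideal.span_le]
        rintro _ ⟨i, rfl⟩
        exact Ideal.subset_span (Finset.mem_union_left _
          (Finset.mem_image_of_mem _ (Finset.mem_univ i)))
      exact hle (sub_C_constantCoeff_mem_idealOfVars a)
    have hbG' : b ∈ Ideal.span (G' : Set (MvPolynomial (Fin n) ℂ)) :=
      Ideal.span_mono (Finset.coe_subset.mpr Finset.subset_union_right) hb
    have hsplit : a * e + b + h =
        constantCoeff a • e + ((a - C (constantCoeff a)) * e + b) + h := by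
      rw [smul_eq_C_mul]; ring
    rw [hsplit, map_add, map_add, map_smul, quadraticPart_eq_zero hh, add_zero]
    exact add_mem (Submodule.smul_mem _ _ heN)
      (hG'N (quadraticPart_mem_span hG' (add_mem hae hbG')))
  have hB : Module.Finite ℂ (MvPolynomial (Fin n) ℂ ⧸ J') :=
    Module.Finite.of_surjective (Ideal.Quotient.factorₐ ℂ (le_sup_left : J ≤ J')).toLinearMap
      (Ideal.Quotient.factor_surjective le_sup_left)
  have hmult := finrank_le_pointMultiplicity_zero J (Ideal.Quotient.mkₐ ℂ J')
    Ideal.Quotient.mk_surjective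
    (fun g hg => Ideal.Quotient.eq_zero_iff_mem.mpr (Ideal.mem_sup_left hg))
    (fun i => ⟨3, by
      rw [← map_pow]
      exact Ideal.Quotient.eq_zero_iff_mem.mpr (Ideal.mem_sup_right
        (Ideal.pow_mem_pow (Ideal.subset_span (Set.mem_range_self i)) 3))⟩)
  have hquot : Module.finrank ℂ ((quadraticExponents n → ℂ) ⧸ N) ≤
      Module.finrank ℂ (MvPolynomial (Fin n) ℂ ⧸ J') := by
    let Ψ := (Submodule.mapQ (J'.restrictScalars ℂ) N (quadraticPart n) hJ') ∘ₗ
      (Submodule.Quotient.restrictScalarsEquiv ℂ J').symm.toLinearMap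
    refine LinearMap.finrank_le_finrank_of_surjective (f := Ψ) ?_
    intro w
    obtain ⟨y, rfl⟩ := Submodule.Quotient.mk_surjective _ w
    obtain ⟨f, rfl⟩ := quadraticPart_surjective y
    exact ⟨Ideal.Quotient.mk J' f, rfl⟩
  have hN : Module.finrank ℂ N ≤ T.card := finrank_span_finset_le_card T
  have hsum := Submodule.finrank_quotient_add_finrank N
  rw [Module.finrank_fintype_fun_eq_card, Fintype.card_coe, card_quadraticExponents] at hsum
  omega

theorem choose_le_pointMultiplicity_spectralIdeal (hn : 2 < n)
    [Module.Finite ℂ (MvPolynomial (Fin n) ℂ ⧸ spectralIdeal n)] (A : Finset ℕ)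
    (hA : ∀ k ∈ Set.Icc 1 n, k ∉ A → spectralInvariant n k ∈
      Ideal.span {esymm (Fin n) ℂ 1} ⊔ idealOfVars (Fin n) ℂ ^ 3) :
    (n + 1).choose 2 ≤ pointMultiplicity (spectralIdeal n) 0 + A.card := by
  classical
  choose c hc using exists_spectralInvariant_sub_mem_sq hn
  let q : ℕ → MvPolynomial (Fin n) ℂ := fun k =>
    spectralInvariant n k - C (c k) * esymm (Fin n) ℂ 1
  refine (choose_le_pointMultiplicity_add_card (spectralIdeal n) (A.image q) ?_ ?_).trans
    (Nat.add_le_add_left Finset.card_image_le _)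
  · intro g hg
    obtain ⟨k, -, rfl⟩ := Finset.mem_image.mp hg
    exact hc k
  · rw [spectralIdeal, Ideal.span_le]
    rintro _ ⟨k, hk, rfl⟩
    by_cases hkA : k ∈ A
    · refine Ideal.mem_sup_left ?_
      have : spectralInvariant n k = C (c k) * esymm (Fin n) ℂ 1 + q k := by ring
      rw [this]
      exact add_mem (Ideal.mem_sup_left (Ideal.mul_mem_left _ _
        (Ideal.subset_span rfl))) (Ideal.mem_sup_right (Ideal.subset_span
          (Finset.mem_coe.mpr (Finset.mem_image_of_mem q hkA))))
    · have hle : Ideal.span {esymm (Fin n) ℂ 1} ⊔ idealOfVars (Fin n) ℂ ^ 3 ≤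
          Ideal.span {esymm (Fin n) ℂ 1} ⊔
            Ideal.span ((A.image q : Finset _) : Set (MvPolynomial (Fin n) ℂ)) ⊔
            idealOfVars (Fin n) ℂ ^ 3 := sup_le_sup_right le_sup_left _
      exact hle (hA k hk hkA)

theorem six_le_pointMultiplicity_spectralIdeal_three
    [Module.Finite ℂ (MvPolynomial (Fin 3) ℂ ⧸ spectralIdeal 3)] :
    6 ≤ pointMultiplicity (spectralIdeal 3) 0 := by
  obtain ⟨S, _, _, r, hS, -, -, hrank, hmap, hadj, -⟩ :=
    exists_universal_splitting_algebra 3 ℂ (Polynomial.X ^ 3) (Polynomial.monic_X_pow 3)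
      (Polynomial.natDegree_X_pow 3)
  rw [Polynomial.map_pow, Polynomial.map_X] at hmap
  have hsum : ∑ i, r i = 0 := by
    have := congrArg Polynomial.nextCoeff hmap
    rw [Polynomial.prod_X_sub_C_nextCoeff, Polynomial.nextCoeff_of_natDegree_pos (by simp)] at this
    simpa [Polynomial.coeff_X_pow] using this
  -- For $n=3$ the determinant depends on the potential only through $\prod_i(X-v_i)$ and $\sum_i
  -- v_i$.
  have hchar : floquetCharpoly r = floquetCharpoly (0 : Fin 3 → S) := by
    rw [floquetCharpoly_fin_three, floquetCharpoly_fin_three]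
    rw [Fin.prod_univ_three] at hmap
    rw [Fin.sum_univ_three] at hsum
    have hC := congrArg Polynomial.C hsum
    simp only [map_add, map_zero, Pi.zero_apply] at hC ⊢
    linear_combination hmap - hC
  have hrank6 : Module.finrank ℂ S = 6 := hrank
  rw [← hrank6]
  refine finrank_le_pointMultiplicity_zero _ (aeval r) ?_ ?_ ?_
  · rw [← AlgHom.range_eq_top, ← Algebra.adjoin_range_eq_range_aeval, hadj]
  · have hle : spectralIdeal 3 ≤ RingHom.ker (aeval r : MvPolynomial (Fin 3) ℂ →ₐ[ℂ] S) := by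
      rw [spectralIdeal, Ideal.span_le]
      rintro _ ⟨k, -, rfl⟩
      have := map_spectralInvariant (aeval r : MvPolynomial (Fin 3) ℂ →ₐ[ℂ] S).toRingHom k
      have hr : (fun i => (aeval r : MvPolynomial (Fin 3) ℂ →ₐ[ℂ] S).toRingHom (X i)) = r := by
        ext i
        simp
      rw [hr, hchar, sub_self, Polynomial.coeff_zero, mul_zero] at this
      exact this
    exact fun g hg => hle hg
  · intro i
    refine ⟨3, ?_⟩
    have := congrArg (Polynomial.eval (r i)) hmap
    rw [Polynomial.eval_prod, Finset.prod_eq_zero (Finset.mem_univ i) (by simp)] at this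
    simpa using this

theorem two_mul_le_pointMultiplicity_spectralIdeal (hn : 2 < n)
    [Module.Finite ℂ (MvPolynomial (Fin n) ℂ ⧸ spectralIdeal n)] :
    2 * n ≤ pointMultiplicity (spectralIdeal n) 0 := by
  have hone : spectralInvariant n 1 ∈
      Ideal.span {esymm (Fin n) ℂ 1} ⊔ idealOfVars (Fin n) ℂ ^ 3 := by
    rw [spectralInvariant_one hn]
    exact Ideal.mem_sup_left (Ideal.subset_span rfl)
  rcases (by omega : n = 3 ∨ n = 4 ∨ 5 ≤ n) with rfl | rfl | h5
  · exact six_le_pointMultiplicity_spectralIdeal_three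
  · have h := choose_le_pointMultiplicity_spectralIdeal hn {2, 4} (by
      rintro k ⟨h1, h4⟩ hk
      simp only [Finset.mem_insert, Finset.mem_singleton] at hk
      rcases (by omega : k = 1 ∨ k = 3) with rfl | rfl
      · exact hone
      · rw [spectralInvariant_four_three]
        exact sub_mem (Ideal.mem_sup_right (esymm_mem_pow_idealOfVars 3))
          (Ideal.mem_sup_left (Ideal.mul_mem_left _ _ (Ideal.subset_span rfl))))
    have hc : (4 + 1).choose 2 = 10 := rfl
    have hcard : ({2, 4} : Finset ℕ).card = 2 := rfl
    omega
  · have h := choose_le_pointMultiplicity_spectralIdeal hn (Finset.Icc 2 n) (by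
      rintro k ⟨h1, hkn⟩ hk
      rw [Finset.mem_Icc] at hk
      obtain rfl : k = 1 := by omega
      exact hone)
    rw [Nat.card_Icc, Nat.choose_two_right] at h
    -- Here $3n-1=2n+(n-1)$, the target plus the number of quadratic relations; the inequality
    -- already fails for $n=4$.
    have hc : 3 * n - 1 ≤ (n + 1) * (n + 1 - 1) / 2 := by
      rw [Nat.le_div_iff_mul_le two_pos, Nat.add_sub_cancel]
      obtain ⟨m, rfl⟩ := Nat.exists_eq_add_of_le h5
      have : 3 * (5 + m) - 1 = 14 + 3 * m := by omega
      rw [this]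
      nlinarith
    omega

end LowerBound

/-! ### Counting the points -/

theorem theorem3p8 (n : ℕ) (hn : 2 < n) :
    2 * n ≤ pointMultiplicity (spectralIdeal n) 0 ∧
      (MvPolynomial.zeroLocus ℂ (spectralIdeal n)).Finite ∧
      1 ≤ (MvPolynomial.zeroLocus ℂ (spectralIdeal n)).ncard ∧
      ((MvPolynomial.zeroLocus ℂ (spectralIdeal n)).ncard : ℤ) ≤
        (Nat.factorial n : ℤ) - 2 * (n : ℤ) + 1 := by
  obtain ⟨hfin, hle⟩ := finrank_quotient_span_le_factorial (K := ℂ) (n := n)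
    (p := spectralInvariant n) fun k hk => esymm_sub_spectralInvariant_mem hn hk
  have : Module.Finite ℂ (MvPolynomial (Fin n) ℂ ⧸ spectralIdeal n) := hfin
  -- Since `finrank` is $0$ in infinite dimension, this positive lower bound also records that the
  -- multiplicity is finite.
  have hmult := two_mul_le_pointMultiplicity_spectralIdeal hn
  set Z := MvPolynomial.zeroLocus ℂ (spectralIdeal n) with hZ
  -- Stated for arbitrary finite subsets, the bound yields both the finiteness of `Z` and, for all
  -- nonzero points, the count.
  have hbound : ∀ s : Finset (Fin n → ℂ), (s : Set (Fin n → ℂ)) ⊆ Z \ {0} →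
      2 * n + s.card ≤ n.factorial := fun s hs =>
    (Nat.add_le_add_right hmult _).trans ((pointMultiplicity_add_card_le (spectralIdeal n) 0 s
      (fun y hy => (hs hy).1) fun h0 => (hs h0).2 rfl).trans hle)
  have hfinite : (Z \ {0}).Finite := by
    by_contra hinf
    obtain ⟨s, hs, hcard⟩ := Set.Infinite.exists_subset_card_eq hinf (n.factorial + 1)
    have := hbound s hs
    omega
  have hzero : (0 : Fin n → ℂ) ∈ Z := by
    have hle0 : spectralIdeal n ≤ pointIdeal 0 := by
      rw [spectralIdeal, Ideal.span_le]
      rintro _ ⟨k, -, rfl⟩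
      change MvPolynomial.eval 0 (spectralInvariant n k) = 0
      rw [MvPolynomial.eval_zero, constantCoeff_spectralInvariant]
    exact fun p hp => hle0 hp
  have hZfin : Z.Finite := hfinite.of_sdiff (Set.finite_singleton 0)
  have hcard := hbound hfinite.toFinset (by simp)
  rw [← Set.ncard_eq_toFinset_card _ hfinite] at hcard
  have hncard := Set.ncard_sdiff_singleton_add_one hzero hZfin
  refine ⟨hmult, hZfin, by omega, by omega⟩
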